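/- Let $h:\mathbb{R}\to\mathbb{R}$ be a $C^1$ function and let $\mathbb{R}^2\times_h\mathbb{R}$ be $\mathbb{R}^2\times\mathbb{R}$ with the warped metric $\bar g=d\rho^2+\rho^2d\omega^2+e^{2h(\rho)}dt^2$, where $(\rho,\omega)$ are polar coordinates on $\mathbb{R}^2$. An immersed $C^2$ surface oriented by a continuous unit normal field $N$ is called an elliptic Weingarten surface of minimal type if its mean curvature $H=H(N)$ and its extrinsic curvature $K$ (half the sum, respectively the product, of the principal curvatures) satisfy $H=f(H^2-K)$ for some $\epsilon>0$ and some $f\in C^1(-\epsilon,\infty)$ with $f(0)=0$ and $4s\,f'(s)^2<1$ for all $s\in(-\epsilon,\infty)$ (if the surface meets the $t$-axis, the equation is required only off the axis, where the metric is $C^1$). **(Barriers)** Apart from pieces of the horizontal slices $\{t=c\}$, there is no elliptic Weingarten surface of minimal type in $\mathbb{R}^2\times_h\mathbb{R}$, rotationally invariant about the $t$-axis, whose generating curve is the graph of a $C^2$ function $t=t(\rho)$ having a local maximum or a local minimum. Precisely: let $J$ be an interval that is relatively open in $[0,\infty)$ and let $t:J\to\mathbb{R}$ be a $C^2$ function such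 that the surface $\{(x,t(|x|)) : x\in\mathbb{R}^2,\ |x|\in J\}$ is a $C^2$ surface (a condition only if $0\in J$) and is an elliptic Weingarten surface of minimal type. If $t$ has a local maximum or a local minimum at some point of $J$, then $t$ is constant on $J$. -/

import Mathlib

/-- The Euclidean plane, the base of the warped product. -/
abbrev Plane : Type := EuclideanSpace ℝ (Fin 2)

namespace WarpedProduct

noncomputable section

/-- The warped metric `g₂ + e^{2 h(ρ)} dt²` on `ℝ² × ℝ` at the point `p`, where `ρ = ‖p.1‖` is the
distance to the `t`-axis, evaluated on the tangent vectors `v` and `w`. -/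
def metric (h : ℝ → ℝ) (p v w : Plane × ℝ) : ℝ :=
  inner ℝ v.1 w.1 + Real.exp (2 * h ‖p.1‖) * (v.2 * w.2)

/-- The derivative at `p`, in the direction `z`, of the metric coefficient `q ↦ g_q(v, w)` of the
constant fields `v`, `w`. -/
def metricDeriv (h : ℝ → ℝ) (p z v w : Plane × ℝ) : ℝ :=
  fderiv ℝ (fun q => metric h q v w) p z

/-- The Christoffel symbol of the first kind: by the Koszul formula this is `g_p(∇_v w, z)` for
the Levi-Civita connection `∇` and the constant fields `v`, `w`, `z`. -/
def christoffel (h : ℝ → ℝ) (p v w z : Plane × ℝ) : ℝ :=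
  (metricDeriv h p v w z + metricDeriv h p w v z - metricDeriv h p z v w) / 2

/-- The `i`-th vector of the standard basis of the parameter plane. -/
def basisVec (i : Fin 2) : Plane := EuclideanSpace.single i 1

/-- The matrix of the first fundamental form of the parametrized surface `ψ` at `x`. -/
def firstForm (h : ℝ → ℝ) (ψ : Plane → Plane × ℝ) (x : Plane) : Matrix (Fin 2) (Fin 2) ℝ :=
  Matrix.of fun i j =>
    metric h (ψ x) (fderiv ℝ ψ x (basisVec i)) (fderiv ℝ ψ x (basisVec j))

/-- The matrix of the second fundamental form `g(∇_{∂ᵢ} ∂ⱼψ, N)` of the parametrized surface `ψ`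
at `x`, with respect to the normal field `N`; here
`g(∇_{∂ᵢ} ∂ⱼψ, N) = g(∂ᵢ∂ⱼψ, N) + Γ(∂ᵢψ, ∂ⱼψ, N)`. -/
def secondForm (h : ℝ → ℝ) (ψ N : Plane → Plane × ℝ) (x : Plane) : Matrix (Fin 2) (Fin 2) ℝ :=
  Matrix.of fun i j =>
    metric h (ψ x) (fderiv ℝ (fun y => fderiv ℝ ψ y (basisVec j)) x (basisVec i)) (N x)
      + christoffel h (ψ x) (fderiv ℝ ψ x (basisVec i)) (fderiv ℝ ψ x (basisVec j)) (N x)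

/-- The matrix of the shape operator; its eigenvalues are the principal curvatures. -/
def shapeOperator (h : ℝ → ℝ) (ψ N : Plane → Plane × ℝ) (x : Plane) :
    Matrix (Fin 2) (Fin 2) ℝ :=
  (firstForm h ψ x)⁻¹ * secondForm h ψ N x

/-- The mean curvature `H(N) = (κ₁ + κ₂) / 2`. -/
def meanCurvature (h : ℝ → ℝ) (ψ N : Plane → Plane × ℝ) (x : Plane) : ℝ :=
  (shapeOperator h ψ N x).trace / 2

/-- The extrinsic curvature `K = κ₁ κ₂`. -/
def extrinsicCurvature (h : ℝ → ℝ) (ψ N : Plane → Plane × ℝ) (x : Plane) : ℝ :=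
  (shapeOperator h ψ N x).det

/-- `N` is a continuous unit normal field along the surface `ψ` with parameter domain `U`. -/
structure IsUnitNormal (h : ℝ → ℝ) (U : Set Plane) (ψ N : Plane → Plane × ℝ) : Prop where
  continuousOn : ContinuousOn N U
  unit : ∀ x ∈ U, metric h (ψ x) (N x) (N x) = 1
  normal : ∀ x ∈ U, ∀ v : Plane, metric h (ψ x) (N x) (fderiv ℝ ψ x v) = 0

/-- `f` is a `C¹` elliptic function of minimal type on `(-ε, ∞)`. -/
structure IsEllipticMinimalType (ε : ℝ) (f : ℝ → ℝ) : Prop where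
  pos : 0 < ε
  contDiffOn : ContDiffOn ℝ 1 f (Set.Ioi (-ε))
  map_zero : f 0 = 0
  elliptic : ∀ s ∈ Set.Ioi (-ε), 4 * s * (deriv f s) ^ 2 < 1

/-- `ψ : U → ℝ² ×_h ℝ` is an immersed, oriented `C²` surface which is elliptic Weingarten of
minimal type: `H = f(H² - K)` for some elliptic `f` with `f 0 = 0`. The relation is imposed off the
`t`-axis: for a profile `h` with `h'(0) ≠ 0` the metric is not differentiable on the axis, and
for `h'(0) = 0` the relation at a point of the axis follows from the nearby ones by continuity. -/
structure IsEWMTSurface (h : ℝ → ℝ) (U : Set Plane) (ψ : Plane → Plane × ℝ) : Prop where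
  isOpen : IsOpen U
  contDiffOn : ContDiffOn ℝ 2 ψ U
  immersion : ∀ x ∈ U, Function.Injective (fderiv ℝ ψ x)
  weingarten : ∃ (N : Plane → Plane × ℝ) (ε : ℝ) (f : ℝ → ℝ),
    IsUnitNormal h U ψ N ∧ IsEllipticMinimalType ε f ∧
      ∀ x ∈ U, (ψ x).1 ≠ 0 →
        meanCurvature h ψ N x
          = f (meanCurvature h ψ N x ^ 2 - extrinsicCurvature h ψ N x)

/-- The domain in the plane swept out by the set `J` of radii under rotation about the origin. -/
def rotDomain (J : Set ℝ) : Set Plane := {x | ‖x‖ ∈ J}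

/-- The parametrization over `rotDomain J` of the surface obtained by rotating about the `t`-axis
the generating curve `ρ ↦ (ρ, t(ρ))`. -/
def rotGraph (t : ℝ → ℝ) (x : Plane) : Plane × ℝ := (x, t ‖x‖)

/-- The horizontal slice at height `c`. -/
def slice (c : ℝ) : Set (Plane × ℝ) := {p | p.2 = c}

end

end WarpedProduct

/-!
Write `p = t'` for the slope of the generating curve, `a = exp h` and `W² = 1 + a² p²`. At a point
at distance `ρ > 0` from the axis the shape operator is diagonal in the meridian and parallel
directions, with principal curvatures `c A` and `c B`, where
`A = (p' + h' p (2 + a² p²)) / W²`, `B = p / ρ` and `c² = a² / W²`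
(`profileEquation_of_weingarten`). The Weingarten relation reads `H = f (d²)` with
`d = c (A - B) / 2`, `H = c (A + B) / 2`.

Ellipticity says that `x ↦ f (x²)` is a strict contraction, so `f (s)² < s` for `s > 0`; and since
`f` is differentiable with `f 0 = 0`, `f (s)²` is even `o(s)` at `0`. Hence close to umbilic points
the surface is almost minimal: `|A + B| ≤ |B| / 2` (`IsEllipticMinimalType.exists_pinching`).

* Off the axis, a zero of `p` gives `B = 0`, whence `H² = d²` and so `d = 0`. The pinching then yields
  `|p'| ≤ C |p|` nearby, and `p` vanishes near that point by uniqueness for linear equations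
  (`eventually_eq_zero_of_eq_zero`). By connectedness `p` vanishes at all positive radii.
* A surface that meets the axis does so orthogonally, and `A` and `B` have the same limit `p'(0)`
  there. So the pinching holds near the axis and gives
  `p p' ≤ -p² / (2 ρ) + O(p²) ≤ 0`; as `p(0) = 0`, the function `p²` cannot become positive
  (`eventually_eq_zero_of_axis`). No extremum is needed in this case.

An extremum at a positive radius is a zero of `p`, and an extremum on the axis is covered by the
second case; either way `p = 0` and `t` is constant.
-/

namespace WarpedProduct

open Set Filter Topology

/-! ### Elliptic functions of minimal type -/

/-- For `r > 0` the function `x ↦ f (x ^ 2)` has derivative `2 x f'(x²)`, of absolute value less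
than one by ellipticity, and it vanishes at `0`; hence `|f (r ^ 2)| < r`. -/
theorem IsEllipticMinimalType.sq_lt {ε : ℝ} {f : ℝ → ℝ} (hf : IsEllipticMinimalType ε f)
    {s : ℝ} (hs : 0 < s) : f s ^ 2 < s := by
  have hdiff : ∀ x : ℝ, HasDerivAt (fun x => f (x ^ 2)) (deriv f (x ^ 2) * (2 * x)) x := by
    intro x
    have hmem : x ^ 2 ∈ Ioi (-ε) := by
      have := hf.pos
      simp only [mem_Ioi]; nlinarith [sq_nonneg x]
    have h1 : DifferentiableAt ℝ f (x ^ 2) :=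
      (hf.contDiffOn.differentiableOn (by norm_num)).differentiableAt (isOpen_Ioi.mem_nhds hmem)
    have h2 : HasDerivAt (fun x : ℝ => x ^ 2) (2 * x) x := by simpa using hasDerivAt_pow 2 x
    exact HasDerivAt.comp (h₂ := f) x h1.hasDerivAt h2
  have hr : 0 < √s := Real.sqrt_pos.2 hs
  obtain ⟨ξ, -, hslope⟩ := exists_hasDerivAt_eq_slope (fun x => f (x ^ 2)) _ hr
    (fun x _ => (hdiff x).continuousAt.continuousWithinAt) (fun x _ => hdiff x)
  have hell := hf.elliptic (ξ ^ 2) (by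
    have := hf.pos
    simp only [mem_Ioi]; nlinarith [sq_nonneg ξ])
  have hs2 : √s ^ 2 = s := Real.sq_sqrt hs.le
  simp only [hs2, ne_eq, OfNat.ofNat_ne_zero, not_false_eq_true, zero_pow, hf.map_zero, sub_zero]
    at hslope
  rw [eq_div_iff hr.ne'] at hslope
  rw [← hslope, mul_pow, hs2]
  nlinarith [hell]

/-- Since `f` is differentiable at `0` with `f 0 = 0`, the square `f ^ 2` is `O(s ^ 2)` there, hence
small compared with `s`. -/
theorem IsEllipticMinimalType.exists_sq_le {ε : ℝ} {f : ℝ → ℝ} (hf : IsEllipticMinimalType ε f) :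
    ∃ δ > 0, ∀ s, 0 ≤ s → s < δ → f s ^ 2 ≤ s / 25 := by
  have hmem : (0 : ℝ) ∈ Ioi (-ε) := by simpa using hf.pos
  have h1 : DifferentiableAt ℝ f 0 :=
    (hf.contDiffOn.differentiableOn (by norm_num)).differentiableAt (isOpen_Ioi.mem_nhds hmem)
  have hO := h1.isBigO_sub
  obtain ⟨C, hC, hb⟩ := hO.exists_pos
  obtain ⟨δ, hδ, hball⟩ := Metric.eventually_nhds_iff.1 hb.bound
  refine ⟨min δ (1 / (25 * C ^ 2)), lt_min hδ (by positivity), fun s hs0 hs => ?_⟩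
  have h2 := hball (y := s) (by
    rw [Real.dist_eq, sub_zero, abs_of_nonneg hs0]; exact hs.trans_le (min_le_left _ _))
  rw [hf.map_zero, sub_zero, sub_zero, Real.norm_eq_abs, Real.norm_eq_abs,
    abs_of_nonneg hs0] at h2
  have h3 : s * (25 * C ^ 2) < 1 := by
    have := hs.trans_le (min_le_right _ _)
    rwa [lt_div_iff₀ (by positivity)] at this
  have h4 : f s ^ 2 ≤ (C * s) ^ 2 := by
    rw [← sq_abs]
    exact pow_le_pow_left₀ (abs_nonneg _) h2 2
  nlinarith

/-- Near umbilic points the Weingarten relation for the principal curvatures `c * A`, `c * B`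
pinches their sum: the surface is nearly minimal. -/
theorem IsEllipticMinimalType.exists_pinching {ε : ℝ} {f : ℝ → ℝ}
    (hf : IsEllipticMinimalType ε f) :
    ∃ δ > 0, ∀ A B c : ℝ, c ≠ 0 → c ^ 2 * ((A - B) ^ 2 / 4) < δ →
      c * ((A + B) / 2) = f (c ^ 2 * ((A - B) ^ 2 / 4)) → |A + B| ≤ |B| / 2 := by
  obtain ⟨δ, hδ, h⟩ := hf.exists_sq_le
  refine ⟨δ, hδ, fun A B c hc hlt heq => ?_⟩
  have h1 := h _ (by positivity) hlt
  rw [← heq] at h1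
  have hc2 : 0 < c ^ 2 := by positivity
  have h2 : (A + B) ^ 2 ≤ ((A - B) / 5) ^ 2 := by
    refine le_of_mul_le_mul_left ?_ hc2
    nlinarith
  have h3 : |A + B| ≤ |(A - B) / 5| := sq_le_sq.1 h2
  have h4 : |A - B| ≤ |A + B| + 2 * |B| := by
    have := abs_sub (A + B) (2 * B)
    rw [abs_mul, abs_two] at this
    calc |A - B| = |A + B - 2 * B| := by ring_nf
      _ ≤ _ := this
  rw [abs_div, abs_of_pos (by norm_num : (0 : ℝ) < 5)] at h3
  linarith

/-! ### The curvature equation of the generating curve -/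

noncomputable section

/-- The principal curvature along the meridian of the rotational surface with generating curve
`t = t(ρ)`, `t' = p`, divided by a factor common to both principal curvatures. -/
def meridianTerm (h p : ℝ → ℝ) (ρ : ℝ) : ℝ :=
  (deriv p ρ + deriv h ρ * p ρ * (2 + Real.exp (h ρ) ^ 2 * p ρ ^ 2)) /
    (1 + Real.exp (h ρ) ^ 2 * p ρ ^ 2)

/-- The square of the factor common to both principal curvatures. -/
def curvFactorSq (h p : ℝ → ℝ) (ρ : ℝ) : ℝ :=
  Real.exp (h ρ) ^ 2 / (1 + Real.exp (h ρ) ^ 2 * p ρ ^ 2)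

/-- The Weingarten relation `H = f (H ^ 2 - K)` at radius `ρ`, written for the slope `p` of the
generating curve; the sign of `c` is that of the chosen unit normal. -/
def ProfileEquation (h f p : ℝ → ℝ) (ρ : ℝ) : Prop :=
  ∃ c : ℝ, c ^ 2 = curvFactorSq h p ρ ∧
    c * ((meridianTerm h p ρ + p ρ / ρ) / 2)
      = f (c ^ 2 * ((meridianTerm h p ρ - p ρ / ρ) ^ 2 / 4))

end

theorem curvFactorSq_pos (h p : ℝ → ℝ) (ρ : ℝ) : 0 < curvFactorSq h p ρ := by
  unfold curvFactorSq; positivity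

theorem ProfileEquation.deriv_eq_zero {ε : ℝ} {h f p : ℝ → ℝ} {ρ : ℝ}
    (hf : IsEllipticMinimalType ε f) (he : ProfileEquation h f p ρ) (hp : p ρ = 0) :
    deriv p ρ = 0 := by
  obtain ⟨c, hc, heq⟩ := he
  have hc2 : 0 < c ^ 2 := hc ▸ curvFactorSq_pos h p ρ
  by_contra hne
  have hA : meridianTerm h p ρ = deriv p ρ := by simp [meridianTerm, hp]
  rw [hA, hp, zero_div, add_zero, sub_zero] at heq
  have hpos : 0 < c ^ 2 * (deriv p ρ ^ 2 / 4) := by positivity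
  have := hf.sq_lt hpos
  rw [← heq] at this
  exact absurd this (by rw [not_lt]; exact le_of_eq (by ring))

theorem continuousAt_meridianTerm {h p : ℝ → ℝ} {ρ : ℝ} (hh : ContDiff ℝ 1 h)
    (hp : ContinuousAt p ρ) (hp' : ContinuousAt (deriv p) ρ) :
    ContinuousAt (meridianTerm h p) ρ := by
  have h1 : ContinuousAt (deriv h) ρ := (hh.continuous_deriv le_rfl).continuousAt
  have h2 : ContinuousAt (fun x => Real.exp (h x)) ρ := hh.continuous.rexp.continuousAt
  unfold meridianTerm
  exact ContinuousAt.div (by fun_prop) (by fun_prop) (by positivity)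

theorem continuousAt_curvFactorSq {h p : ℝ → ℝ} {ρ : ℝ} (hh : ContDiff ℝ 1 h)
    (hp : ContinuousAt p ρ) : ContinuousAt (curvFactorSq h p) ρ := by
  have h2 : ContinuousAt (fun x => Real.exp (h x)) ρ := hh.continuous.rexp.continuousAt
  unfold curvFactorSq
  exact ContinuousAt.div (by fun_prop) (by fun_prop) (by positivity)

theorem deriv_eq_meridianTerm (h p : ℝ → ℝ) (ρ : ℝ) :
    deriv p ρ = (1 + Real.exp (h ρ) ^ 2 * p ρ ^ 2) * meridianTerm h p ρ
      - deriv h ρ * p ρ * (2 + Real.exp (h ρ) ^ 2 * p ρ ^ 2) := by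
  unfold meridianTerm
  rw [mul_div_cancel₀ _ (by positivity)]
  ring

/-- A differentiable function with `|p'| ≤ C |p|` that vanishes at one point vanishes identically:
it solves the linear equation `y' = (p' / p) y`, whose coefficient is bounded by `C`. -/
theorem eqOn_zero_of_abs_deriv_le {p : ℝ → ℝ} {a b x₀ : ℝ} {C : NNReal} (hx₀ : x₀ ∈ Ioo a b)
    (hd : ∀ x ∈ Ioo a b, DifferentiableAt ℝ p x) (hle : ∀ x ∈ Ioo a b, |deriv p x| ≤ C * |p x|)
    (h0 : p x₀ = 0) : EqOn p 0 (Ioo a b) := by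
  refine ODE_solution_unique_of_mem_Ioo (v := fun x y => deriv p x / p x * y)
    (s := fun _ => univ) (K := C) (t₀ := x₀) ?_ hx₀ ?_ ?_ h0
  · intro x hx
    refine LipschitzWith.lipschitzOnWith (LipschitzWith.of_dist_le_mul fun y z => ?_)
    rw [Real.dist_eq, Real.dist_eq, ← mul_sub, abs_mul, abs_div]
    gcongr
    exact div_le_of_le_mul₀ (abs_nonneg _) C.2 (hle x hx)
  · intro x hx
    refine ⟨?_, mem_univ _⟩
    -- where `p` vanishes, so does `p'`, and the convention `p' / 0 = 0` gives the right value
    have : deriv p x / p x * p x = deriv p x := by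
      by_cases hp : p x = 0
      · have := hle x hx
        rw [hp, abs_zero, mul_zero] at this
        rw [hp, mul_zero, abs_nonpos_iff.1 this]
      · exact div_mul_cancel₀ _ hp
    simpa only [this] using (hd x hx).hasDerivAt
  · intro x _
    exact ⟨by simp [hasDerivAt_zero], mem_univ _⟩

/-- Off the axis, the surface is umbilic, with both curvatures zero, wherever the slope vanishes; the
pinching then gives `|p'| ≤ C |p|` nearby. -/
theorem eventually_eq_zero_of_eq_zero {ε : ℝ} {h f p : ℝ → ℝ} {ρ₀ : ℝ} (hρ₀ : 0 < ρ₀)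
    (hh : ContDiff ℝ 1 h) (hf : IsEllipticMinimalType ε f)
    (hd : ∀ᶠ ρ in 𝓝 ρ₀, DifferentiableAt ℝ p ρ) (hc : ContinuousAt (deriv p) ρ₀)
    (he : ∀ᶠ ρ in 𝓝 ρ₀, ProfileEquation h f p ρ) (h0 : p ρ₀ = 0) :
    ∀ᶠ ρ in 𝓝 ρ₀, p ρ = 0 := by
  have hpc : ContinuousAt p ρ₀ := hd.self_of_nhds.continuousAt
  have hA := continuousAt_meridianTerm hh hpc hc
  have hS := continuousAt_curvFactorSq hh hpc
  have hB : ContinuousAt (fun ρ => p ρ / ρ) ρ₀ := hpc.div continuousAt_id hρ₀.ne'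
  obtain ⟨δ, hδ, hpinch⟩ := hf.exists_pinching
  have hsmall : ∀ᶠ ρ in 𝓝 ρ₀,
      curvFactorSq h p ρ * ((meridianTerm h p ρ - p ρ / ρ) ^ 2 / 4) < δ := by
    have hcont : ContinuousAt
        (fun ρ => curvFactorSq h p ρ * ((meridianTerm h p ρ - p ρ / ρ) ^ 2 / 4)) ρ₀ :=
      hS.mul (((hA.sub hB).pow 2).div_const 4)
    refine hcont.eventually_lt_const ?_
    simpa [meridianTerm, h0, he.self_of_nhds.deriv_eq_zero hf h0] using hδ
  -- a continuous function bounding the ratio `|p'| / |p|`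
  set k : ℝ → ℝ := fun ρ => (1 + Real.exp (h ρ) ^ 2 * p ρ ^ 2) * (3 / 2 * (1 / ρ))
      + |deriv h ρ| * (2 + Real.exp (h ρ) ^ 2 * p ρ ^ 2) with hk
  have hkc : ContinuousAt k ρ₀ := by
    have h1 : ContinuousAt (deriv h) ρ₀ := (hh.continuous_deriv le_rfl).continuousAt
    have h2 : ContinuousAt (fun x => Real.exp (h x)) ρ₀ := hh.continuous.rexp.continuousAt
    have h3 : ContinuousAt (fun x : ℝ => 1 / x) ρ₀ := continuousAt_const.div continuousAt_id hρ₀.ne'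
    simp only [hk]
    fun_prop
  have hkpos : 0 ≤ k ρ₀ := by simp only [hk]; positivity
  have hkb : ∀ᶠ ρ in 𝓝 ρ₀, k ρ < k ρ₀ + 1 := hkc.eventually_lt_const (by linarith)
  obtain ⟨r, hr, hball⟩ := Metric.eventually_nhds_iff_ball.1
    (hd.and (he.and (hsmall.and (hkb.and (eventually_gt_nhds hρ₀)))))
  rw [Real.ball_eq_Ioo] at hball
  have hle : ∀ ρ ∈ Ioo (ρ₀ - r) (ρ₀ + r),
      |deriv p ρ| ≤ (⟨k ρ₀ + 1, by linarith⟩ : NNReal) * |p ρ| := by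
    intro ρ hρ
    obtain ⟨-, ⟨c, hcs, heq⟩, hs, hkρ, hpos⟩ := hball ρ hρ
    have hcne : c ≠ 0 := by
      rintro rfl
      exact (curvFactorSq_pos h p ρ).ne (by simpa using hcs)
    rw [← hcs] at hs
    have hAB := hpinch _ _ c hcne hs heq
    have hA' : |meridianTerm h p ρ| ≤ 3 / 2 * (1 / ρ) * |p ρ| := by
      have h1 := abs_sub (meridianTerm h p ρ + p ρ / ρ) (p ρ / ρ)
      rw [add_sub_cancel_right] at h1
      have h2 : |p ρ / ρ| = 1 / ρ * |p ρ| := by rw [abs_div, abs_of_pos hpos]; ring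
      rw [h2] at h1 hAB
      linarith
    have hW : 0 < 1 + Real.exp (h ρ) ^ 2 * p ρ ^ 2 := by positivity
    have hW' : 0 < 2 + Real.exp (h ρ) ^ 2 * p ρ ^ 2 := by positivity
    calc |deriv p ρ| ≤ |(1 + Real.exp (h ρ) ^ 2 * p ρ ^ 2) * meridianTerm h p ρ|
          + |deriv h ρ * p ρ * (2 + Real.exp (h ρ) ^ 2 * p ρ ^ 2)| := by
            rw [deriv_eq_meridianTerm h p ρ]; exact abs_sub _ _
      _ = (1 + Real.exp (h ρ) ^ 2 * p ρ ^ 2) * |meridianTerm h p ρ|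
          + |deriv h ρ| * |p ρ| * (2 + Real.exp (h ρ) ^ 2 * p ρ ^ 2) := by
            rw [abs_mul, abs_mul, abs_mul, abs_of_pos hW, abs_of_pos hW']
      _ ≤ (1 + Real.exp (h ρ) ^ 2 * p ρ ^ 2) * (3 / 2 * (1 / ρ) * |p ρ|)
          + |deriv h ρ| * |p ρ| * (2 + Real.exp (h ρ) ^ 2 * p ρ ^ 2) := by gcongr
      _ = k ρ * |p ρ| := by simp only [hk]; ring
      _ ≤ (k ρ₀ + 1) * |p ρ| := by gcongr
  have hzero := eqOn_zero_of_abs_deriv_le (x₀ := ρ₀) ⟨by linarith, by linarith⟩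
    (fun ρ hρ => (hball ρ hρ).1) hle h0
  filter_upwards [Ioo_mem_nhds (by linarith : ρ₀ - r < ρ₀) (by linarith : ρ₀ < ρ₀ + r)] with ρ hρ
  exact hzero hρ

/-- At the axis the two principal curvatures agree in the limit, so the pinching makes their sum
small and the equation resembles `p' = -p / ρ`: then `p ^ 2` decreases from its value `0`. -/
theorem eventually_eq_zero_of_axis {ε : ℝ} {h f p : ℝ → ℝ}
    (hh : ContDiff ℝ 1 h) (hf : IsEllipticMinimalType ε f)
    (hd : ∀ᶠ ρ in 𝓝 0, DifferentiableAt ℝ p ρ) (hc : ContinuousAt (deriv p) 0)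
    (he : ∀ᶠ ρ in 𝓝[>] 0, ProfileEquation h f p ρ) (h0 : p 0 = 0) :
    ∀ᶠ ρ in 𝓝[>] 0, p ρ = 0 := by
  have hpc : ContinuousAt p 0 := hd.self_of_nhds.continuousAt
  have hA := continuousAt_meridianTerm hh hpc hc
  have hS := continuousAt_curvFactorSq hh hpc
  have hB : Tendsto (fun ρ => p ρ / ρ) (𝓝[>] 0) (𝓝 (deriv p 0)) := by
    have := (hasDerivAt_iff_tendsto_slope_zero.1 hd.self_of_nhds.hasDerivAt).mono_left
      (nhdsWithin_mono 0 fun x (hx : 0 < x) => hx.ne')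
    refine this.congr fun ρ => ?_
    rw [zero_add, h0, sub_zero, smul_eq_mul, div_eq_inv_mul]
  obtain ⟨δ, hδ, hpinch⟩ := hf.exists_pinching
  have hsmall : ∀ᶠ ρ in 𝓝[>] 0,
      curvFactorSq h p ρ * ((meridianTerm h p ρ - p ρ / ρ) ^ 2 / 4) < δ := by
    have hlim : Tendsto
        (fun ρ => curvFactorSq h p ρ * ((meridianTerm h p ρ - p ρ / ρ) ^ 2 / 4)) (𝓝[>] 0) _ :=
      (hS.tendsto.mono_left nhdsWithin_le_nhds).mul
        ((((hA.tendsto.mono_left nhdsWithin_le_nhds).sub hB).pow 2).div_const 4)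
    refine hlim.eventually_lt_const ?_
    simpa [meridianTerm, h0] using hδ
  set k : ℝ → ℝ := fun ρ => 2 * ρ * |deriv h ρ| * (2 + Real.exp (h ρ) ^ 2 * p ρ ^ 2) with hk
  have hkb : ∀ᶠ ρ in 𝓝[>] 0, k ρ < 1 := by
    have h1 : ContinuousAt (deriv h) 0 := (hh.continuous_deriv le_rfl).continuousAt
    have h2 : ContinuousAt (fun x => Real.exp (h x)) 0 := hh.continuous.rexp.continuousAt
    have hkc : ContinuousAt k 0 := by simp only [hk]; fun_prop
    exact (hkc.tendsto.mono_left nhdsWithin_le_nhds).eventually_lt_const (by simp [hk])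
  obtain ⟨r, hr, hsub⟩ := mem_nhdsGT_iff_exists_Ioo_subset.1
    ((hd.filter_mono nhdsWithin_le_nhds).and (he.and (hsmall.and hkb)))
  rw [mem_Ioi] at hr
  have hanti : AntitoneOn (fun ρ => p ρ ^ 2) (Ico 0 r) := by
    have hdiff : ∀ ρ ∈ Ioo 0 r, HasDerivAt (fun ρ => p ρ ^ 2) (2 * p ρ * deriv p ρ) ρ := by
      intro ρ hρ
      simpa using (hsub hρ).1.hasDerivAt.fun_pow 2
    refine antitoneOn_of_deriv_nonpos (convex_Ico 0 r) ?_ ?_ ?_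
    · intro ρ hρ
      rcases hρ.1.eq_or_lt with rfl | hpos
      · exact (hpc.pow 2).continuousWithinAt
      · exact (hdiff ρ ⟨hpos, hρ.2⟩).continuousAt.continuousWithinAt
    · rw [interior_Ico]
      exact fun ρ hρ => (hdiff ρ hρ).differentiableAt.differentiableWithinAt
    · rw [interior_Ico]
      intro ρ hρ
      obtain ⟨-, ⟨c, hcs, heq⟩, hs, hkρ⟩ := hsub hρ
      have hpos : 0 < ρ := hρ.1
      have hcne : c ≠ 0 := by
        rintro rfl
        exact (curvFactorSq_pos h p ρ).ne (by simpa using hcs)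
      rw [← hcs] at hs
      have hAB := hpinch _ _ c hcne hs heq
      rw [(hdiff ρ hρ).deriv]
      set A := meridianTerm h p ρ with hAdef
      set w := Real.exp (h ρ) ^ 2 * p ρ ^ 2 with hw
      have hw0 : 0 ≤ w := by positivity
      have h1 : p ρ * A ≤ -(p ρ ^ 2 / (2 * ρ)) := by
        have h2 : |p ρ * (A + p ρ / ρ)| ≤ p ρ ^ 2 / (2 * ρ) := by
          rw [abs_mul]
          calc |p ρ| * |A + p ρ / ρ| ≤ |p ρ| * (|p ρ / ρ| / 2) := by gcongr
            _ = p ρ ^ 2 / (2 * ρ) := by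
              rw [abs_div, abs_of_pos hpos, ← sq_abs]; field_simp
        have h3 := (abs_le.1 h2).2
        have h4 : p ρ * (A + p ρ / ρ) = p ρ * A + 2 * (p ρ ^ 2 / (2 * ρ)) := by field_simp
        linarith
      have h5 : (1 + w) * (p ρ * A) ≤ -(p ρ ^ 2 / (2 * ρ)) := by
        have : 0 ≤ p ρ ^ 2 / (2 * ρ) := by positivity
        nlinarith
      have h6 : -(deriv h ρ * (2 + w)) ≤ 1 / (2 * ρ) := by
        rw [le_div_iff₀ (by positivity)]
        have h7 : -deriv h ρ ≤ |deriv h ρ| := neg_le_abs _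
        have h8 : 0 ≤ 2 * ρ * (2 + w) := by positivity
        have := mul_le_mul_of_nonneg_left h7 h8
        have hk' : 2 * ρ * |deriv h ρ| * (2 + w) < 1 := hkρ
        linarith
      have h9 := mul_le_mul_of_nonneg_left h6 (sq_nonneg (p ρ))
      have h10 : p ρ * deriv p ρ
          = (1 + w) * (p ρ * A) + p ρ ^ 2 * -(deriv h ρ * (2 + w)) := by
        rw [deriv_eq_meridianTerm h p ρ]; ring
      have h11 : p ρ ^ 2 * (1 / (2 * ρ)) = p ρ ^ 2 / (2 * ρ) := by ring
      linarith
  filter_upwards [Ioo_mem_nhdsGT hr] with ρ hρ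
  have := hanti ⟨le_rfl, hr⟩ ⟨hρ.1.le, hρ.2⟩ hρ.1.le
  simp only [h0] at this
  exact pow_eq_zero_iff two_ne_zero |>.1 (le_antisymm (by simpa using this) (sq_nonneg _))

/-- On an interval of positive radii the zeros of the slope form a closed and open set. -/
theorem eqOn_zero_of_profileEquation {ε : ℝ} {h f p : ℝ → ℝ} {I : Set ℝ} (hI : IsOpen I)
    (hIc : IsPreconnected I) (hIpos : ∀ ρ ∈ I, 0 < ρ) (hh : ContDiff ℝ 1 h)
    (hf : IsEllipticMinimalType ε f) (hd : ∀ ρ ∈ I, DifferentiableAt ℝ p ρ)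
    (hc : ∀ ρ ∈ I, ContinuousAt (deriv p) ρ) (he : ∀ ρ ∈ I, ProfileEquation h f p ρ)
    {ρ₀ : ℝ} (hρ₀ : ρ₀ ∈ I) (h0 : p ρ₀ = 0) : ∀ ρ ∈ I, p ρ = 0 := by
  have key : ∀ ρ ∈ I, p ρ = 0 → ∀ᶠ x in 𝓝 ρ, p x = 0 := fun ρ hρ hz =>
    eventually_eq_zero_of_eq_zero (hIpos ρ hρ) hh hf
      (Filter.mem_of_superset (hI.mem_nhds hρ) hd) (hc ρ hρ)
      (Filter.mem_of_superset (hI.mem_nhds hρ) he) hz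
  have hsub : I ⊆ {ρ | ∀ᶠ x in 𝓝 ρ, p x = 0} := by
    refine hIc.subset_of_closure_inter_subset isOpen_setOfPred_eventually_nhds
      ⟨ρ₀, hρ₀, key ρ₀ hρ₀ h0⟩ ?_
    rintro ρ ⟨hcl, hρ⟩
    refine key ρ hρ ?_
    have hmaps : MapsTo p {ρ | ∀ᶠ x in 𝓝 ρ, p x = 0} {0} := by
      intro x hx
      have hx' : ∀ᶠ y in 𝓝 x, p y = 0 := hx
      exact hx'.self_of_nhds
    have := (hd ρ hρ).continuousAt.continuousWithinAt.mem_closure hcl hmaps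
    simpa using this
  intro ρ hρ
  have hρ' : ∀ᶠ x in 𝓝 ρ, p x = 0 := hsub hρ
  exact hρ'.self_of_nhds

/-! ### The curvatures of a rotational graph -/

theorem hasFDerivAt_norm_plane {y : Plane} (hy : y ≠ 0) :
    HasFDerivAt (fun z : Plane => ‖z‖) (‖y‖⁻¹ • innerSL ℝ y) y := by
  have h1 := (hasStrictFDerivAt_norm_sq y).hasFDerivAt.sqrt (by simpa using hy)
  have h2 : (fun z : Plane => √(‖z‖ ^ 2)) = fun z => ‖z‖ :=
    funext fun z => Real.sqrt_sq (norm_nonneg z)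
  rw [h2, Real.sqrt_sq (norm_nonneg y)] at h1
  refine h1.congr_fderiv ?_
  ext v
  simp
  ring

theorem hasFDerivAt_rotGraph {t : ℝ → ℝ} {d : ℝ} {y : Plane} (hy : y ≠ 0)
    (ht : HasDerivAt t d ‖y‖) :
    HasFDerivAt (rotGraph t)
      ((ContinuousLinearMap.id ℝ Plane).prod (d • ‖y‖⁻¹ • innerSL ℝ y)) y :=
  (hasFDerivAt_id y).prodMk (ht.comp_hasFDerivAt y (hasFDerivAt_norm_plane hy))

theorem metricDeriv_eq {h : ℝ → ℝ} {p : Plane × ℝ} (hp : p.1 ≠ 0)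
    (hh : DifferentiableAt ℝ h ‖p.1‖) (z v w : Plane × ℝ) :
    metricDeriv h p z v w = Real.exp (2 * h ‖p.1‖) * (2 * (deriv h ‖p.1‖ *
      (‖p.1‖⁻¹ * inner ℝ p.1 z.1))) * (v.2 * w.2) := by
  have h1 : HasFDerivAt (fun q : Plane × ℝ => ‖q.1‖)
      ((‖p.1‖⁻¹ • innerSL ℝ p.1).comp (ContinuousLinearMap.fst ℝ Plane ℝ)) p :=
    (hasFDerivAt_norm_plane hp).comp p hasFDerivAt_fst
  have h2 := ((hh.hasDerivAt.comp_hasFDerivAt p h1).const_mul 2).exp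
  have h3 := (h2.mul_const (v.2 * w.2)).const_add (inner ℝ v.1 w.1)
  have h4 : metricDeriv h p z v w = _ := congrArg (fun L => L z) h3.fderiv
  rw [h4]
  simp
  ring

theorem hasFDerivAt_fderiv_rotGraph {t p : ℝ → ℝ} {x : Plane} {d : ℝ} (hx : x ≠ 0)
    (ht : ∀ᶠ r in 𝓝 ‖x‖, HasDerivAt t (p r) r) (hp : HasDerivAt p d ‖x‖) (v : Plane) :
    HasFDerivAt (fun y => fderiv ℝ (rotGraph t) y v)
      ((0 : Plane →L[ℝ] Plane).prod
        (p ‖x‖ • (‖x‖⁻¹ • innerSL ℝ v + inner ℝ x v • (-(‖x‖ ^ 2)⁻¹) • ‖x‖⁻¹ • innerSL ℝ x)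
          + (‖x‖⁻¹ * inner ℝ x v) • d • ‖x‖⁻¹ • innerSL ℝ x)) x := by
  have hn := hasFDerivAt_norm_plane hx
  have hx' : ‖x‖ ≠ 0 := norm_ne_zero_iff.2 hx
  have hev : (fun y => fderiv ℝ (rotGraph t) y v)
      =ᶠ[𝓝 x] fun y => (v, p ‖y‖ * (‖y‖⁻¹ * inner ℝ y v)) := by
    filter_upwards [continuous_norm.continuousAt.eventually ht, eventually_ne_nhds hx] with y hy hy0
    rw [(hasFDerivAt_rotGraph hy0 hy).fderiv]
    simp
  refine HasFDerivAt.congr_of_eventuallyEq ?_ hev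
  refine (hasFDerivAt_const v x).prodMk ?_
  have hinv := (hasDerivAt_inv hx').comp_hasFDerivAt x hn
  have hin : HasFDerivAt (fun y : Plane => (inner ℝ y v : ℝ)) (innerSL ℝ v) x := by
    refine ((innerSL ℝ v).hasFDerivAt).congr_of_eventuallyEq (Eventually.of_forall fun y => ?_)
    simp [real_inner_comm]
  exact (hp.comp_hasFDerivAt x hn).mul (hinv.mul hin)

theorem exp_two_mul_eq (a : ℝ) : Real.exp (2 * a) = Real.exp a ^ 2 := by
  rw [two_mul, Real.exp_add, sq]

/-- On the half-line `ℝ_{> 0} e₀` the shape operator is diagonal in the basis of the meridian and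
parallel directions. -/
theorem profileEquation_of_weingarten {h t p f : ℝ → ℝ} {N : Plane → Plane × ℝ} {J : Set ℝ} {ρ : ℝ}
    (hρ : 0 < ρ) (hρJ : ρ ∈ J) (hh : ContDiff ℝ 1 h)
    (ht : ∀ᶠ r in 𝓝 ρ, HasDerivAt t (p r) r) (hp : DifferentiableAt ℝ p ρ)
    (hN : IsUnitNormal h (rotDomain J) (rotGraph t) N)
    (hW : ∀ x ∈ rotDomain J, (rotGraph t x).1 ≠ 0 →
      meanCurvature h (rotGraph t) N x = f (meanCurvature h (rotGraph t) N x ^ 2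
        - extrinsicCurvature h (rotGraph t) N x)) :
    ProfileEquation h f p ρ := by
  set x : Plane := EuclideanSpace.single 0 ρ with hxdef
  have hnorm : ‖x‖ = ρ := by simp [hxdef, abs_of_pos hρ]
  have hx0 : x ≠ 0 := norm_ne_zero_iff.1 (by rw [hnorm]; exact hρ.ne')
  have hxJ : x ∈ rotDomain J := by simpa [rotDomain, hnorm] using hρJ
  have hψ1 : (rotGraph t x).1 = x := rfl
  have e00 : ∀ v : Plane, inner ℝ x v = ρ * v 0 := by
    intro v; simp [hxdef, EuclideanSpace.inner_single_left]
  have hD : ∀ v, fderiv ℝ (rotGraph t) x v = (v, p ρ * v 0) := by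
    intro v
    rw [(hasFDerivAt_rotGraph (d := p ρ) hx0 (by rw [hnorm]; exact ht.self_of_nhds)).fderiv]
    simp [e00, hnorm, hρ.ne']
  have hD2 : ∀ v w, fderiv ℝ (fun y => fderiv ℝ (rotGraph t) y v) x w
      = (0, p ρ / ρ * (v 1 * w 1) + deriv p ρ * (v 0 * w 0)) := by
    intro v w
    rw [(hasFDerivAt_fderiv_rotGraph (d := deriv p ρ) hx0 (by rw [hnorm]; exact ht)
      (by rw [hnorm]; exact hp.hasDerivAt) v).fderiv]
    simp [e00, hnorm, PiLp.inner_apply, Fin.sum_univ_two]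
    field_simp
    ring
  set a := Real.exp (h ρ) with ha
  have hmd : ∀ z v w, metricDeriv h (rotGraph t x) z v w
      = 2 * a ^ 2 * deriv h ρ * z.1 0 * (v.2 * w.2) := by
    intro z v w
    rw [metricDeriv_eq (by rw [hψ1]; exact hx0) (hh.differentiable one_ne_zero _), hψ1, e00, hnorm,
      exp_two_mul_eq, ← ha]
    field_simp
  have hm : ∀ v w, metric h (rotGraph t x) v w
      = v.1 0 * w.1 0 + v.1 1 * w.1 1 + a ^ 2 * (v.2 * w.2) := by
    intro v w
    rw [metric, hψ1, hnorm, exp_two_mul_eq, ← ha, PiLp.inner_apply, Fin.sum_univ_two]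
    simp [mul_comm]
  set n := (N x).2 with hn
  have hN1 : (N x).1 1 = 0 := by
    have := hN.normal x hxJ (basisVec 1)
    rw [hD, hm] at this
    simpa [basisVec] using this
  have hN0 : (N x).1 0 = -(a ^ 2 * p ρ * n) := by
    have := hN.normal x hxJ (basisVec 0)
    rw [hD, hm] at this
    simp [basisVec] at this
    linarith
  have hu : a ^ 2 * n ^ 2 * (1 + a ^ 2 * p ρ ^ 2) = 1 := by
    have := hN.unit x hxJ
    rw [hm, hN1, hN0, ← hn] at this
    linarith
  have hWpos : 0 < 1 + a ^ 2 * p ρ ^ 2 := by positivity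
  have hI : firstForm h (rotGraph t) x = Matrix.diagonal ![1 + a ^ 2 * p ρ ^ 2, 1] := by
    ext i j
    fin_cases i <;> fin_cases j <;> simp [firstForm, hm, hD, basisVec]
    exact Or.inl (sq _).symm
  have hII : secondForm h (rotGraph t) N x = Matrix.diagonal
      ![a ^ 2 * n * (deriv p ρ + deriv h ρ * p ρ * (2 + a ^ 2 * p ρ ^ 2)),
        a ^ 2 * n * (p ρ / ρ)] := by
    ext i j
    fin_cases i <;> fin_cases j <;>
      simp [secondForm, christoffel, hm, hmd, hD, hD2, basisVec, hN0, hN1, ← hn]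
    · ring
    · ring
  have hS : shapeOperator h (rotGraph t) N x
      = Matrix.diagonal ![a ^ 2 * n * meridianTerm h p ρ, a ^ 2 * n * (p ρ / ρ)] := by
    have hinv : (Matrix.diagonal ![1 + a ^ 2 * p ρ ^ 2, 1])⁻¹
        = Matrix.diagonal ![(1 + a ^ 2 * p ρ ^ 2)⁻¹, 1] := by
      refine Matrix.inv_eq_left_inv ?_
      rw [Matrix.diagonal_mul_diagonal, ← Matrix.diagonal_one]
      congr 1
      ext i
      fin_cases i
      · simpa using inv_mul_cancel₀ hWpos.ne'
      · simp
    rw [shapeOperator, hI, hII, hinv, Matrix.diagonal_mul_diagonal]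
    congr 1
    ext i
    fin_cases i
    · simp [meridianTerm, ← ha]; ring
    · simp
  have hH : meanCurvature h (rotGraph t) N x
      = a ^ 2 * n * ((meridianTerm h p ρ + p ρ / ρ) / 2) := by
    rw [meanCurvature, hS, Matrix.trace_diagonal, Fin.sum_univ_two]
    simp; ring
  have hK : extrinsicCurvature h (rotGraph t) N x
      = a ^ 2 * n * meridianTerm h p ρ * (a ^ 2 * n * (p ρ / ρ)) := by
    rw [extrinsicCurvature, hS, Matrix.det_diagonal, Fin.prod_univ_two]
    simp
  refine ⟨a ^ 2 * n, ?_, ?_⟩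
  · rw [curvFactorSq, ← ha, eq_div_iff hWpos.ne']
    calc (a ^ 2 * n) ^ 2 * (1 + a ^ 2 * p ρ ^ 2)
        = a ^ 2 * (a ^ 2 * n ^ 2 * (1 + a ^ 2 * p ρ ^ 2)) := by ring
      _ = a ^ 2 := by rw [hu, mul_one]
  · rw [← hH, hW x hxJ (by rw [hψ1]; exact hx0), hK, hH]
    congr 1
    ring

end WarpedProduct

/-! ### Rigidity of the generating curve -/

open Set Filter Topology WarpedProduct in
/-- `J` is an interval of radii, relatively open in `[0, ∞)`: either `(a, b)` with `0 ≤ a`, or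
`[0, b)`, in which case the surface crosses the `t`-axis. If the profile `t` has a local maximum or
minimum on `J`, the rotational surface is a piece of a horizontal slice. -/
theorem mainTheorem10 (h : ℝ → ℝ) (hh : ContDiff ℝ 1 h)
    (J : Set ℝ) (hJ : J.OrdConnected) (hJopen : ∃ O : Set ℝ, IsOpen O ∧ J = O ∩ Set.Ici 0)
    (t : ℝ → ℝ) (ht : ContDiffOn ℝ 2 t J)
    (hsurf : WarpedProduct.IsEWMTSurface h (WarpedProduct.rotDomain J) (WarpedProduct.rotGraph t))
    (hextr : ∃ ρ₀ ∈ J, IsLocalMaxOn t J ρ₀ ∨ IsLocalMinOn t J ρ₀) :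
    ∃ c : ℝ, WarpedProduct.rotGraph t '' WarpedProduct.rotDomain J ⊆ WarpedProduct.slice c := by
  obtain ⟨N, ε, f, hN, hf, hW⟩ := hsurf.weingarten
  obtain ⟨ρ₀, hρ₀, hext⟩ := hextr
  have hJpos : ∀ ρ ∈ J, 0 ≤ ρ := by
    obtain ⟨O, -, rfl⟩ := hJopen
    exact fun ρ hρ => hρ.2
  -- the even extension of the generating curve is `C²` because it is a section of the surface
  set F : ℝ → ℝ := fun s => t |s| with hF
  set V : Set ℝ := {s | |s| ∈ J} with hV
  have hlineC : ContDiff ℝ 2 (fun s : ℝ => (EuclideanSpace.single 0 s : Plane)) := by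
    have : (fun s : ℝ => (EuclideanSpace.single 0 s : Plane))
        = fun s => s • EuclideanSpace.single 0 1 := by
      ext s i; fin_cases i <;> simp
    rw [this]
    exact contDiff_id.smul contDiff_const
  have hVpre : V = (fun s : ℝ => (EuclideanSpace.single 0 s : Plane)) ⁻¹' rotDomain J := by
    ext s; simp [hV, rotDomain]
  have hVo : IsOpen V := hVpre ▸ hsurf.isOpen.preimage hlineC.continuous
  have hFC : ContDiffOn ℝ 2 F V := by
    have h1 : ContDiffOn ℝ 2 (fun x : Plane => (rotGraph t x).2) (rotDomain J) :=
      hsurf.contDiffOn.snd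
    have h2 := h1.comp hlineC.contDiffOn (s := V) (by rw [hVpre]; exact mapsTo_preimage _ _)
    refine h2.congr fun s _ => ?_
    simp [hF, rotGraph]
  have hFeven : ∀ s, F (-s) = F s := fun s => by simp [hF]
  have hJV : J ⊆ V := fun s hs => by simpa [hV, abs_of_nonneg (hJpos s hs)] using hs
  set p : ℝ → ℝ := deriv F with hp
  have hFd : ∀ s ∈ V, HasDerivAt F (p s) s := fun s hs =>
    ((hFC.differentiableOn two_ne_zero).differentiableAt (hVo.mem_nhds hs)).hasDerivAt
  have hpC : ContDiffOn ℝ 1 p V := ((contDiffOn_succ_iff_deriv_of_isOpen (n := 1) hVo).1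
    (by simpa [one_add_one_eq_two] using hFC)).2.2
  have hpd : ∀ s ∈ V, DifferentiableAt ℝ p s := fun s hs =>
    (hpC.differentiableOn one_ne_zero).differentiableAt (hVo.mem_nhds hs)
  have hpc : ∀ s ∈ V, ContinuousAt (deriv p) s := fun s hs =>
    (hpC.continuousOn_deriv_of_isOpen hVo le_rfl).continuousAt (hVo.mem_nhds hs)
  have hp0 : p 0 = 0 := by
    have h1 : deriv (fun s => F (-s)) 0 = -p 0 := by rw [deriv_comp_neg, neg_zero]
    rw [funext hFeven] at h1
    have : p 0 = -p 0 := h1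
    linarith
  have heq : ∀ ρ ∈ J, 0 < ρ → ProfileEquation h f p ρ := by
    intro ρ hρ hpos
    refine profileEquation_of_weingarten hpos hρ hh ?_ (hpd ρ (hJV hρ)) hN hW
    filter_upwards [hVo.mem_nhds (hJV hρ), eventually_gt_nhds hpos] with r hr hr0
    refine (hFd r hr).congr_of_eventuallyEq ?_
    filter_upwards [eventually_gt_nhds hr0] with s hs
    simp [hF, abs_of_pos hs]
  set I : Set ℝ := V ∩ Ioi 0 with hI
  have hIJ : I = J ∩ Ioi 0 := by
    ext s
    refine and_congr_left fun hs => ?_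
    have hs' : 0 < s := hs
    simp [hV, abs_of_pos hs']
  -- one zero of the slope off the axis, from which all the others follow
  obtain ⟨ρ₁, hρ₁, hz⟩ : ∃ ρ₁ ∈ I, p ρ₁ = 0 := by
    rcases (hJpos ρ₀ hρ₀).eq_or_lt with h0 | hpos
    · have hV0 : V ∈ 𝓝 (0 : ℝ) := hVo.mem_nhds (h0 ▸ hJV hρ₀)
      have hI0 : ∀ᶠ ρ in 𝓝[>] (0 : ℝ), ρ ∈ I :=
        inter_mem (nhdsWithin_le_nhds hV0) self_mem_nhdsWithin
      have hz := eventually_eq_zero_of_axis hh hf (Filter.mem_of_superset hV0 hpd)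
        (hpc 0 (mem_of_mem_nhds hV0))
        (hI0.mono fun ρ hρ => by rw [hIJ] at hρ; exact heq ρ hρ.1 hρ.2) hp0
      exact (hI0.and hz).exists
    · refine ⟨ρ₀, hIJ ▸ ⟨hρ₀, hpos⟩, ?_⟩
      have hIn : J ∈ 𝓝 ρ₀ := by
        have hIo : I ∈ 𝓝 ρ₀ := (hVo.inter isOpen_Ioi).mem_nhds ⟨hJV hρ₀, hpos⟩
        exact mem_of_superset hIo (hIJ ▸ inter_subset_left)
      have hFt : F =ᶠ[𝓝 ρ₀] t := by
        filter_upwards [eventually_gt_nhds hpos] with s hs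
        simp [hF, abs_of_pos hs]
      rw [hp, hFt.deriv_eq]
      rcases hext with hmax | hmin
      · exact (hmax.isLocalMax hIn).deriv_eq_zero
      · exact (hmin.isLocalMin hIn).deriv_eq_zero
  have hall := eqOn_zero_of_profileEquation (hVo.inter isOpen_Ioi)
    (hI ▸ hIJ ▸ (hJ.inter ordConnected_Ioi).isPreconnected) (fun ρ hρ => hρ.2) hh hf
    (fun ρ hρ => hpd ρ hρ.1) (fun ρ hρ => hpc ρ hρ.1)
    (fun ρ hρ => heq ρ (hIJ.subset hρ).1 hρ.2) hρ₁ hz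
  have hconst : ∀ ρ ∈ J, F ρ = F ρ₀ := by
    intro ρ hρ
    have hder : ∀ s ∈ J, HasDerivWithinAt F (p s) J s := fun s hs =>
      (hFd s (hJV hs)).hasDerivWithinAt
    have hbound : ∀ s ∈ J, ‖p s‖ ≤ 0 := by
      intro s hs
      rcases (hJpos s hs).eq_or_lt with rfl | hpos
      · simp [hp0]
      · simp [hall s ⟨hJV hs, hpos⟩]
    have := Convex.norm_image_sub_le_of_norm_hasDerivWithin_le hder hbound hJ.convex hρ₀ hρ
    rw [zero_mul, norm_le_zero_iff, sub_eq_zero] at this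
    exact this
  refine ⟨F ρ₀, ?_⟩
  rintro _ ⟨x, hx, rfl⟩
  have := hconst ‖x‖ hx
  simpa [slice, rotGraph, hF] using this
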